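/- **Setting.** Let $G$ be a transitive permutation group on a finite set $\Omega$, $n=|\Omega|$. Vectors are row vectors indexed by $\Omega$, $\mathbb 1$ is the all-ones vector, $J$ the all-ones matrix, and $v^g$ is the vector with $(v^g)_{\omega^g}=v_\omega$. A *homogeneous coherent configuration* is a partition $\{R_0,\dots,R_d\}$ of $\Omega\times\Omega$ into nonempty relations, with $R_0$ the identity, closed under converse, such that for $(x,y)\in R_k$ the number $p_{ij}^k$ of $z$ with $(x,z)\in R_i$, $(z,y)\in R_j$ depends only on $i,j,k$; it is *commutative* (an *association scheme*) if $p_{ij}^k=p_{ji}^k$ always. $\mathcal K(G)$ is the configuration of the orbits of $G$ on $\Omega\times\Omega$. Its *symmetrisation* $\mathcal K(G)^{\mathrm{Sym}}$ replaces each relation by its union with its converse; $\mathcal K(G)$ is *stratifiable* if $\mathcal K(G)^{\mathrm{Sym}}$ is an association scheme. For a configuration let $\mathcal A$ be the complex algebra generated by the adjacency matrices of its relations; $u,v\in\mathbb C\Omega$ are *design-orthogonal* in it if $(u\Pi u^*)(v\Pi v^*)=0$ for every central primitive idempotent $\Pi\neq\frac1nJ$ of $\mathcal A$. Call a real vector *nontrivial*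 if it has at least two distinct entries and at most $n-2$ zero entries. *Witnesses* are defined as follows (all vectors being nontrivial). * Nontrivial $w,x$ with non-negative integer entries are *witnesses for non-$\mathbb Q$I* if $w\cdot x^g$ is constant over $g\in G$. ($G$ is a $\mathbb Q$I-group if it is transitive and its permutation module over $\mathbb Q$ is the direct sum of the trivial module and an irreducible module.) * A nontrivial $\{0,1\}$-vector $u$ and a nontrivial $w$ with non-negative integer entries such that $w\cdot\mathbb 1$ divides $n$ are *witnesses for nonspreading* if there is a positive integer $\lambda$ with $w\cdot u^g=\lambda$ for all $g\in G$. ($G$ is nonspreading if such witnesses exist.) * Nontrivial $\{0,1\}$-vectors $u,v$ with $(u\cdot\mathbb 1)(v\cdot\mathbb 1)=n$ are *witnesses for nonseparating* if $u\cdot v^g=1$ for all $g\in G$. ($G$ is nonseparating if such witnesses exist.) * Nontrivial $\{0,1\}$-vectors $y_1,\dots,y_m$ with $\sum_{i=1}^m y_i=\mathbb 1$ and a nontrivial $\{0,1\}$-vector $v$ are *witnesses for nonsynchronising* if $y_i\cdot v^g=1$ for all $i$ and all $g\in G$. ($G$ is synchronising if for every non-bijective map $f:\Omega\to\Omega$ the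 monoid $\langle G,f\rangle$ contains a constant map.) **Theorem (Synchronisation hierarchy).** Let $u,v,y_1,\dots,y_m$ be nontrivial $\{0,1\}$-vectors and $w,x$ nontrivial vectors with non-negative integer entries (in each part only the vectors named there are involved). (a) If $w$ and $x$ are design-orthogonal in $\mathcal K(G)$, then they are witnesses for non-$\mathbb Q$I, and $G$ is not a $\mathbb Q$I-group. If $w$ and $x$ are witnesses for non-$\mathbb Q$I, then they are design-orthogonal in $\mathcal K(G)^{\mathrm{Sym}}$ when $\mathcal K(G)$ is stratifiable, and in $\mathcal K(G)$ when $\mathcal K(G)$ is commutative. (b) Let $w\cdot\mathbb 1$ divide $n$. If $u$ and $w$ are design-orthogonal in $\mathcal K(G)$, then they are witnesses for nonspreading, and $G$ is nonspreading. If $u$ and $w$ are witnesses for nonspreading, then they are design-orthogonal in $\mathcal K(G)^{\mathrm{Sym}}$ when $\mathcal K(G)$ is stratifiable, and in $\mathcal K(G)$ when $\mathcal K(G)$ is commutative. (c) Let $(u\cdot\mathbb 1)(v\cdot\mathbb 1)=n$. If $u$ and $v$ are design-orthogonal in $\mathcal K(G)$, then they are witnesses for nonseparating, and $G$ is nonseparating.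 If $u$ and $v$ are witnesses for nonseparating, then they are design-orthogonal in $\mathcal K(G)^{\mathrm{Sym}}$ when $\mathcal K(G)$ is stratifiable, and in $\mathcal K(G)$ when $\mathcal K(G)$ is commutative. (d) Let $(y_i\cdot\mathbb 1)(v\cdot\mathbb 1)=n$ for $1\le i\le m$ and $\sum_{i=1}^m y_i=\mathbb 1$. If $y_i$ and $v$ are design-orthogonal in $\mathcal K(G)$ for all $i$, then $y_1,\dots,y_m$ and $v$ are witnesses for nonsynchronising, and $G$ is not synchronising. If $y_1,\dots,y_m$ and $v$ are witnesses for nonsynchronising, then, for all $i$, $y_i$ and $v$ are design-orthogonal in $\mathcal K(G)^{\mathrm{Sym}}$ when $\mathcal K(G)$ is stratifiable, and in $\mathcal K(G)$ when $\mathcal K(G)$ is commutative. -/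

import Mathlib

noncomputable section

namespace SyncHierarchy

universe u₁ u₂

/-! ### Coherent configurations (given by their set of relations) -/

/-- The converse of a binary relation, relations being sets of ordered pairs. -/
def converse {Ω : Type u₁} (R : Set (Ω × Ω)) : Set (Ω × Ω) := {p | (p.2, p.1) ∈ R}

/-- The number of `z` with `(x, z) ∈ R` and `(z, y) ∈ S`. -/
def pathCount {Ω : Type u₁} (R S : Set (Ω × Ω)) (x y : Ω) : ℕ :=
  Set.ncard {z : Ω | (x, z) ∈ R ∧ (z, y) ∈ S}

/-- A homogeneous coherent configuration on `Ω`: a partition of `Ω × Ω` into nonempty relations,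
containing the identity relation, closed under converse, and with well-defined
intersection numbers. -/
structure IsHomogeneousCoherent {Ω : Type u₁} (𝓡 : Set (Set (Ω × Ω))) : Prop where
  partition : Setoid.IsPartition 𝓡
  diagonal_mem : Set.diagonal Ω ∈ 𝓡
  converse_mem : ∀ R ∈ 𝓡, converse R ∈ 𝓡
  coherent : ∀ R ∈ 𝓡, ∀ S ∈ 𝓡, ∀ T ∈ 𝓡, ∀ p ∈ T, ∀ q ∈ T,
    pathCount R S p.1 p.2 = pathCount R S q.1 q.2

/-- Commutativity: the intersection numbers `p_{ij}^k` and `p_{ji}^k` agree. -/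
def IsCommutative {Ω : Type u₁} (𝓡 : Set (Set (Ω × Ω))) : Prop :=
  ∀ R ∈ 𝓡, ∀ S ∈ 𝓡, ∀ x y : Ω, pathCount R S x y = pathCount S R x y

/-- An association scheme is a commutative homogeneous coherent configuration. -/
def IsAssociationScheme {Ω : Type u₁} (𝓡 : Set (Set (Ω × Ω))) : Prop :=
  IsHomogeneousCoherent 𝓡 ∧ IsCommutative 𝓡

/-- The symmetrisation: every relation is replaced by its union with its converse
(a symmetric relation is therefore kept). -/
def symmetrisation {Ω : Type u₁} (𝓡 : Set (Set (Ω × Ω))) : Set (Set (Ω × Ω)) :=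
  {S | ∃ R ∈ 𝓡, S = R ∪ converse R}

/-- A configuration is stratifiable if its symmetrisation is an association scheme. -/
def IsStratifiable {Ω : Type u₁} (𝓡 : Set (Set (Ω × Ω))) : Prop :=
  IsAssociationScheme (symmetrisation 𝓡)

/-- The orbital configuration `K(G)`: the set of orbits of `G` on ordered pairs. -/
def orbitals (G : Type u₂) (Ω : Type u₁) [Group G] [MulAction G Ω] : Set (Set (Ω × Ω)) :=
  {R | ∃ p : Ω × Ω, R = MulAction.orbit G p}

/-- The orbitals of a transitive group form a homogeneous coherent configuration. -/
theorem isHomogeneousCoherent_orbitals (G : Type u₂) (Ω : Type u₁) [Group G] [MulAction G Ω]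
    [MulAction.IsPretransitive G Ω] [Nonempty Ω] : IsHomogeneousCoherent (orbitals G Ω) where
  partition := by
    refine ⟨?_, fun p => ⟨MulAction.orbit G p, ⟨⟨p, rfl⟩, MulAction.mem_orbit_self p⟩, ?_⟩⟩
    · rintro ⟨p, hp⟩
      exact (MulAction.nonempty_orbit p).ne_empty hp.symm
    · rintro _ ⟨⟨q, rfl⟩, hq⟩
      exact (MulAction.orbit_eq_iff.mpr hq).symm
  diagonal_mem := by
    obtain ⟨x⟩ := ‹Nonempty Ω›
    refine ⟨(x, x), Set.ext ?_⟩
    rintro ⟨a, b⟩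
    constructor
    · intro h
      obtain rfl : a = b := h
      obtain ⟨g, rfl⟩ := MulAction.exists_smul_eq G x a
      exact ⟨g, rfl⟩
    · rintro ⟨g, hg⟩
      have h := Prod.ext_iff.mp hg
      exact h.1.symm.trans h.2
  converse_mem := by
    rintro _ ⟨⟨a, b⟩, rfl⟩
    refine ⟨(b, a), Set.ext ?_⟩
    rintro ⟨c, d⟩
    constructor
    · rintro ⟨g, hg⟩
      have h := Prod.ext_iff.mp hg
      exact ⟨g, Prod.ext h.2 h.1⟩
    · rintro ⟨g, hg⟩
      have h := Prod.ext_iff.mp hg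
      exact ⟨g, Prod.ext h.2 h.1⟩
  coherent := by
    rintro _ ⟨r, rfl⟩ _ ⟨s, rfl⟩ _ ⟨t, rfl⟩ p hp q hq
    have hpq : q ∈ MulAction.orbit G p := by
      rw [MulAction.orbit_eq_iff.mpr hp]; exact hq
    obtain ⟨g, rfl⟩ := hpq
    have key : ∀ (r : Ω × Ω) (a b : Ω),
        (g • a, g • b) ∈ MulAction.orbit G r ↔ (a, b) ∈ MulAction.orbit G r := by
      intro r a b
      rw [← Prod.smul_mk, ← MulAction.orbit_eq_iff, ← MulAction.orbit_eq_iff,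
        MulAction.orbit_smul]
    refine Set.ncard_congr (fun z _ => g • z) ?_ ?_ ?_
    · rintro z ⟨h1, h2⟩
      exact ⟨(key r _ _).mpr h1, (key s _ _).mpr h2⟩
    · intro a b _ _ h
      exact MulAction.injective g h
    · rintro z ⟨h1, h2⟩
      refine ⟨g⁻¹ • z, ⟨(key r _ _).mp ?_, (key s _ _).mp ?_⟩, smul_inv_smul g z⟩
      · rw [smul_inv_smul]; exact h1
      · rw [smul_inv_smul]; exact h2

/-! ### The adjacency algebra and design-orthogonality -/

/-- The adjacency matrix of a relation, with complex entries. -/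
def adjMatrix {Ω : Type u₁} (R : Set (Ω × Ω)) : Matrix Ω Ω ℂ :=
  Matrix.of fun x y => Set.indicator R (fun _ => (1 : ℂ)) (x, y)

/-- The complex algebra generated by the adjacency matrices. -/
def adjAlgebra {Ω : Type u₁} [Fintype Ω] [DecidableEq Ω] (𝓡 : Set (Set (Ω × Ω))) :
    Subalgebra ℂ (Matrix Ω Ω ℂ) :=
  Algebra.adjoin ℂ (adjMatrix '' 𝓡)

/-- `P` is an idempotent in the centre of the algebra `𝒜`. -/
def IsCentralIdempotent {Ω : Type u₁} [Fintype Ω] [DecidableEq Ω]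
    (𝒜 : Subalgebra ℂ (Matrix Ω Ω ℂ)) (P : Matrix Ω Ω ℂ) : Prop :=
  P ∈ 𝒜 ∧ P * P = P ∧ ∀ A ∈ 𝒜, P * A = A * P

/-- `P` is a central primitive idempotent of `𝒜`: a nonzero central idempotent above no central
idempotents other than `0` and itself. -/
def IsCentralPrimitiveIdempotent {Ω : Type u₁} [Fintype Ω] [DecidableEq Ω]
    (𝒜 : Subalgebra ℂ (Matrix Ω Ω ℂ)) (P : Matrix Ω Ω ℂ) : Prop :=
  IsCentralIdempotent 𝒜 P ∧ P ≠ 0 ∧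
    ∀ Q, IsCentralIdempotent 𝒜 Q → P * Q = Q → Q = 0 ∨ Q = P

/-- The principal idempotent `J / n`, where `J` is the all-ones matrix and `n = |Ω|`. -/
def principalIdempotent (Ω : Type u₁) [Fintype Ω] : Matrix Ω Ω ℂ :=
  Matrix.of fun _ _ => (Fintype.card Ω : ℂ)⁻¹

/-- The number `u P u*` for a row vector `u`. -/
def hermForm {Ω : Type u₁} [Fintype Ω] (P : Matrix Ω Ω ℂ) (u : Ω → ℂ) : ℂ :=
  ∑ i, ∑ j, u i * P i j * star (u j)

/-- `u` and `v` are design-orthogonal: `(u Π u*) (v Π v*) = 0` for every nonprincipal central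
primitive idempotent `Π` of the adjacency algebra. -/
def DesignOrthogonal {Ω : Type u₁} [Fintype Ω] [DecidableEq Ω] (𝓡 : Set (Set (Ω × Ω)))
    (u v : Ω → ℂ) : Prop :=
  ∀ P, IsCentralPrimitiveIdempotent (adjAlgebra 𝓡) P → P ≠ principalIdempotent Ω →
    hermForm P u * hermForm P v = 0

/-- A real vector seen as a complex vector. -/
def toComplex {Ω : Type u₁} (u : Ω → ℝ) : Ω → ℂ := fun ω => (u ω : ℂ)

/-! ### Vectors -/

/-- All entries are `0` or `1`. -/
def IsZeroOne {Ω : Type u₁} (u : Ω → ℝ) : Prop := ∀ ω, u ω = 0 ∨ u ω = 1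

/-- All entries are non-negative integers. -/
def IsNatVector {Ω : Type u₁} (u : Ω → ℝ) : Prop := ∀ ω, ∃ k : ℕ, u ω = k

/-- There are at least two distinct entries, and at most `|Ω| - 2` entries are zero. -/
def IsNontrivial {Ω : Type u₁} [Fintype Ω] (u : Ω → ℝ) : Prop :=
  (∃ a b, u a ≠ u b) ∧ Set.ncard {ω | u ω = 0} + 2 ≤ Fintype.card Ω

/-- The size `u · 𝟙` of a vector (of a multiset, if the entries are multiplicities). -/
def size {Ω : Type u₁} [Fintype Ω] (u : Ω → ℝ) : ℝ := ∑ ω, u ω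

/-- The real dot product. -/
def dot {Ω : Type u₁} [Fintype Ω] (u v : Ω → ℝ) : ℝ := ∑ ω, u ω * v ω

/-- The translate `v^g`, whose entry at `g • ω` is the entry of `v` at `ω`. -/
def translate {G : Type u₂} {Ω : Type u₁} {k : Type*} [Group G] [MulAction G Ω]
    (g : G) (v : Ω → k) : Ω → k := fun ω => v (g⁻¹ • ω)

/-! ### Witnesses -/

/-- `w`, `x` are (the characteristic vectors of) nontrivial multisets whose generalised
intersection `w · x^g` does not depend on `g`. -/
def IsNonQIWitness (G : Type u₂) {Ω : Type u₁} [Group G] [MulAction G Ω] [Fintype Ω]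
    (w x : Ω → ℝ) : Prop :=
  IsNatVector w ∧ IsNontrivial w ∧ IsNatVector x ∧ IsNontrivial x ∧
    ∃ c : ℝ, ∀ g : G, dot w (translate g x) = c

/-- `u` is a nontrivial set and `w` a nontrivial multiset of size dividing `|Ω|`, and there is a
positive integer `l` with `w · u^g = l` for all `g`. -/
def IsNonspreadingWitness (G : Type u₂) {Ω : Type u₁} [Group G] [MulAction G Ω] [Fintype Ω]
    (u w : Ω → ℝ) : Prop :=
  IsZeroOne u ∧ IsNontrivial u ∧ IsNatVector w ∧ IsNontrivial w ∧
    (∃ d : ℕ, size w = d ∧ d ∣ Fintype.card Ω) ∧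
    ∃ l : ℕ, 0 < l ∧ ∀ g : G, dot w (translate g u) = l

/-- `u`, `v` are nontrivial sets with `|u| |v| = |Ω|`, and each translate of `v` meets `u` in
exactly one point. -/
def IsNonseparatingWitness (G : Type u₂) {Ω : Type u₁} [Group G] [MulAction G Ω] [Fintype Ω]
    (u v : Ω → ℝ) : Prop :=
  IsZeroOne u ∧ IsNontrivial u ∧ IsZeroOne v ∧ IsNontrivial v ∧
    size u * size v = Fintype.card Ω ∧
    ∀ g : G, dot u (translate g v) = 1

/-- `y₁, …, y_m` are the parts of a partition of `Ω` into nontrivial sets and `v` is a nontrivial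
set all of whose translates are transversals of the partition. -/
def IsNonsynchronisingWitness (G : Type u₂) {Ω : Type u₁} [Group G] [MulAction G Ω] [Fintype Ω]
    {m : ℕ} (y : Fin m → Ω → ℝ) (v : Ω → ℝ) : Prop :=
  (∀ i, IsZeroOne (y i) ∧ IsNontrivial (y i)) ∧ IsZeroOne v ∧ IsNontrivial v ∧
    (∀ ω, ∑ i, y i ω = 1) ∧
    ∀ i, ∀ g : G, dot (y i) (translate g v) = 1

/-! ### The layers of the hierarchy -/

/-- The permutation module of `G` on `Ω` over `ℚ`. -/
def permModule (G : Type u₂) (Ω : Type u₁) [Group G] [MulAction G Ω] :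
    Representation ℚ G (Ω → ℚ) where
  toFun g :=
    { toFun := fun v => translate g v
      map_add' := fun _ _ => rfl
      map_smul' := fun _ _ => rfl }
  map_one' := by
    refine LinearMap.ext fun v => funext fun ω => ?_
    change v ((1 : G)⁻¹ • ω) = v ω
    rw [inv_one, one_smul]
  map_mul' g h := by
    refine LinearMap.ext fun v => funext fun ω => ?_
    change v ((g * h)⁻¹ • ω) = v (h⁻¹ • g⁻¹ • ω)
    rw [mul_inv_rev, mul_smul]

/-- A QI-group: a transitive group whose rational permutation module is the direct sum of the
trivial module and an irreducible module. -/
def IsQI (G : Type u₂) (Ω : Type u₁) [Group G] [MulAction G Ω] : Prop :=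
  MulAction.IsPretransitive G Ω ∧
    ∃ T W : Subrepresentation (permModule G Ω), IsCompl T W ∧
      Module.finrank ℚ T.toSubmodule = 1 ∧ T.toRepresentation.IsTrivial ∧
      W.toRepresentation.IsIrreducible

/-- A nonspreading group: there are a nontrivial multiset of size dividing `|Ω|` and a nontrivial
set with constant positive generalised intersection under translation. -/
def IsNonspreading (G : Type u₂) (Ω : Type u₁) [Group G] [MulAction G Ω] [Fintype Ω] : Prop :=
  ∃ u w : Ω → ℝ, IsNonspreadingWitness G u w

/-- A nonseparating group. -/
def IsNonseparating (G : Type u₂) (Ω : Type u₁) [Group G] [MulAction G Ω] [Fintype Ω] : Prop :=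
  ∃ u v : Ω → ℝ, IsNonseparatingWitness G u v

/-- A synchronising group: together with any non-permutation of `Ω`, it generates a
transformation monoid that contains a constant map. -/
def IsSynchronising (G : Type u₂) (Ω : Type u₁) [Group G] [MulAction G Ω] : Prop :=
  ∀ f : Function.End Ω, ¬ Function.Bijective f →
    ∃ c : Ω, (fun _ => c : Function.End Ω) ∈
      Submonoid.closure (insert f (Set.range (MulAction.toEndHom : G →* Function.End Ω)))

end SyncHierarchy

end

namespace SyncHierarchy

open Matrix
open scoped ComplexOrder

/-! ### Self-adjoint matrix algebras and their central idempotents. -/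

section Algebra

variable {Ω : Type*} [Fintype Ω] [DecidableEq Ω]

/-! Averaging over the transitive group `G` shows that if `w · x^g` is constant, its value is
`|w||x|/n` (`dot_translate_eq_of_forall_eq`). All four parts compare this condition with
design-orthogonality.

From design-orthogonality (`dot_translate_of_designOrthogonal`): the algebra is closed under
adjoints, so its central idempotents `P` are orthogonal projections and `uPu*` is the squared norm
of `uP`. Thus every nonprincipal primitive `P` kills `w` or `x`. Since `P` commutes with `G`, only
the `J/n` component contributes to `w · x^g`.

Conversely (`designOrthogonal_of_dot_translate`): centre `x` to `y` and let `M` be the sum over `g`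
of the rank-one matrices of `y^g`. It is symmetric and `G`-invariant, hence in the algebra, and `Mw
= 0`. Commutativity gives `PM = cP`. If `c ≠ 0` then `P` kills `w`; if `c = 0`, the trace of `PM`
shows that `P` kills `y`, hence `x`.

Two group-theoretic conclusions remain: `not_isQI_of_isNonQIWitness` builds a proper nonzero
submodule, and `not_isSynchronising_of_isNonsynchronisingWitness` builds a map that generates no
constant map with `G`. -/

theorem adjMatrix_mem {𝓡 : Set (Set (Ω × Ω))} {R : Set (Ω × Ω)} (hR : R ∈ 𝓡) :
    adjMatrix R ∈ adjAlgebra 𝓡 :=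
  Algebra.subset_adjoin ⟨R, hR, rfl⟩

omit [Fintype Ω] [DecidableEq Ω] in
theorem conjTranspose_adjMatrix (R : Set (Ω × Ω)) :
    (adjMatrix R)ᴴ = adjMatrix (converse R) := by
  ext i j
  by_cases h : (j, i) ∈ R
  · have h' : (i, j) ∈ converse R := h
    simp [adjMatrix, h, h']
  · have h' : (i, j) ∉ converse R := h
    simp [adjMatrix, h, h']

theorem conjTranspose_mem_adjAlgebra {𝓡 : Set (Set (Ω × Ω))}
    (hconv : ∀ R ∈ 𝓡, converse R ∈ 𝓡) {A : Matrix Ω Ω ℂ} (hA : A ∈ adjAlgebra 𝓡) :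
    Aᴴ ∈ adjAlgebra 𝓡 := by
  induction hA using Algebra.adjoin_induction with
  | mem x hx =>
    obtain ⟨R, hR, rfl⟩ := hx
    rw [conjTranspose_adjMatrix]
    exact adjMatrix_mem (hconv R hR)
  | algebraMap r =>
    rw [Algebra.algebraMap_eq_smul_one, conjTranspose_smul, conjTranspose_one]
    exact Subalgebra.smul_mem _ (one_mem _) _
  | add x y _ _ hx hy => rw [conjTranspose_add]; exact add_mem hx hy
  | mul x y _ _ hx hy => rw [conjTranspose_mul]; exact mul_mem hy hx

theorem apply_smul_of_mem_adjAlgebra {G : Type*} [Group G] [MulAction G Ω]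
    {𝓡 : Set (Set (Ω × Ω))} (hinv : ∀ R ∈ 𝓡, ∀ (g : G) (p : Ω × Ω), g • p ∈ R ↔ p ∈ R)
    {A : Matrix Ω Ω ℂ} (hA : A ∈ adjAlgebra 𝓡) (g : G) (i j : Ω) :
    A (g • i) (g • j) = A i j := by
  induction hA using Algebra.adjoin_induction generalizing i j with
  | mem x hx =>
    obtain ⟨R, hR, rfl⟩ := hx
    have h := hinv R hR g (i, j)
    rw [Prod.smul_mk] at h
    by_cases hij : (i, j) ∈ R
    · simp [adjMatrix, hij, h.mpr hij]
    · simp [adjMatrix, hij, mt h.mp hij]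
  | algebraMap r => simp [Matrix.algebraMap_matrix_apply]
  | add x y _ _ hx hy => simp [hx, hy]
  | mul x y _ _ hx hy =>
    rw [mul_apply, mul_apply, ← Equiv.sum_comp (MulAction.toPerm g)]
    exact Finset.sum_congr rfl fun k _ => by rw [MulAction.toPerm_apply, hx, hy]

/-- The constant values serve as coefficients of a linear combination of adjacency matrices. This
puts matrices averaged over the group into the algebra. -/
theorem mem_adjAlgebra_of_forall_mem_eq {𝓡 : Set (Set (Ω × Ω))} (hpart : Setoid.IsPartition 𝓡)
    {M : Matrix Ω Ω ℂ} (hM : ∀ R ∈ 𝓡, ∀ p ∈ R, ∀ q ∈ R, M p.1 p.2 = M q.1 q.2) :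
    M ∈ adjAlgebra 𝓡 := by
  classical
  have hne : ∀ R : 𝓡, (R : Set (Ω × Ω)).Nonempty := fun R =>
    Setoid.nonempty_of_mem_partition hpart R.2
  have hsum : M = ∑ R : 𝓡, M (hne R).some.1 (hne R).some.2 • adjMatrix (R : Set (Ω × Ω)) := by
    ext i j
    obtain ⟨R, ⟨hR, hij⟩, huniq⟩ := hpart.2 (i, j)
    rw [Matrix.sum_apply, Finset.sum_eq_single (⟨R, hR⟩ : 𝓡)]
    · simpa [adjMatrix, hij] using hM R hR (i, j) hij _ (hne ⟨R, hR⟩).some_mem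
    · intro S _ hS
      have : (i, j) ∉ (S : Set (Ω × Ω)) := fun h => hS (Subtype.ext (huniq _ ⟨S.2, h⟩))
      simp [adjMatrix, this]
    · simp
  rw [hsum]
  exact sum_mem fun R _ => Subalgebra.smul_mem _ (adjMatrix_mem R.2) _

omit [DecidableEq Ω] in
theorem adjMatrix_mul_apply (R S : Set (Ω × Ω)) (x y : Ω) :
    (adjMatrix R * adjMatrix S) x y = pathCount R S x y := by
  classical
  rw [pathCount, Set.ncard_eq_toFinset_card', mul_apply, Finset.card_eq_sum_ones, Set.toFinset_ofPred,
    Finset.sum_filter, Nat.cast_sum]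
  refine Finset.sum_congr rfl fun z _ => ?_
  by_cases h1 : (x, z) ∈ R <;> by_cases h2 : (z, y) ∈ S <;> simp [adjMatrix, h1, h2]

theorem mul_comm_of_mem_adjAlgebra {𝓡 : Set (Set (Ω × Ω))} (hcomm : IsCommutative 𝓡)
    {A B : Matrix Ω Ω ℂ} (hA : A ∈ adjAlgebra 𝓡) (hB : B ∈ adjAlgebra 𝓡) : A * B = B * A := by
  refine Algebra.commute_of_mem_adjoin_of_forall_mem_commute (R := ℂ) hB ?_ |>.eq
  rintro _ ⟨S, hS, rfl⟩
  refine (Algebra.commute_of_mem_adjoin_of_forall_mem_commute (R := ℂ) hA ?_).symm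
  rintro _ ⟨R, hR, rfl⟩
  ext x y
  rw [adjMatrix_mul_apply, adjMatrix_mul_apply, hcomm S hS R hR]

/-- Centrality makes `P` commute with its adjoint, and a normal idempotent is an orthogonal
projection: `P - PᴴP` has vanishing Gram matrix, so `P = PᴴP`. -/
theorem IsCentralIdempotent.conjTranspose_eq {𝒜 : Subalgebra ℂ (Matrix Ω Ω ℂ)}
    (hstar : ∀ A ∈ 𝒜, Aᴴ ∈ 𝒜) {P : Matrix Ω Ω ℂ} (hP : IsCentralIdempotent 𝒜 P) : Pᴴ = P := by
  obtain ⟨hmem, hidem, hcen⟩ := hP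
  have hidem' : Pᴴ * Pᴴ = Pᴴ := by rw [← conjTranspose_mul, hidem]
  have hc : P * Pᴴ = Pᴴ * P := hcen _ (hstar P hmem)
  have h0 : (P - Pᴴ * P)ᴴ * (P - Pᴴ * P) = 0 := by
    have e1 : Pᴴ * P * (Pᴴ * P) = Pᴴ * P := by
      rw [mul_assoc, ← mul_assoc P, hc, mul_assoc, hidem, ← mul_assoc, hidem']
    rw [conjTranspose_sub, conjTranspose_mul, conjTranspose_conjTranspose, sub_mul, mul_sub,
      mul_sub, e1, mul_assoc Pᴴ P P, hidem, ← mul_assoc Pᴴ Pᴴ P, hidem']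
    simp
  have h1 : P = Pᴴ * P := sub_eq_zero.mp (conjTranspose_mul_self_eq_zero.mp h0)
  calc Pᴴ = (Pᴴ * P)ᴴ := by rw [← h1]
    _ = Pᴴ * P := by rw [conjTranspose_mul, conjTranspose_conjTranspose]
    _ = P := h1.symm

omit [DecidableEq Ω] in
theorem hermForm_eq (P : Matrix Ω Ω ℂ) (u : Ω → ℂ) : hermForm P u = (u ᵥ* P) ⬝ᵥ star u := by
  simp only [hermForm, dotProduct, vecMul, Pi.star_apply, Finset.sum_mul]
  exact Finset.sum_comm

omit [DecidableEq Ω] in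
theorem vecMul_eq_zero_of_hermForm_eq_zero {P : Matrix Ω Ω ℂ} (hP : P * P = P) (hPs : Pᴴ = P)
    {u : Ω → ℂ} (h : hermForm P u = 0) : u ᵥ* P = 0 := by
  have h1 : hermForm P u = (u ᵥ* P) ⬝ᵥ star (u ᵥ* P) := by
    rw [hermForm_eq, star_vecMul, hPs, dotProduct_mulVec, vecMul_vecMul, hP]
  rwa [h1, dotProduct_self_star_eq_zero] at h

omit [Fintype Ω] [DecidableEq Ω] in
theorem star_toComplex (u : Ω → ℝ) : star (toComplex u) = toComplex u := by
  ext; simp [toComplex]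

omit [DecidableEq Ω] in
theorem mulVec_toComplex_eq_zero_of_vecMul {P : Matrix Ω Ω ℂ} (hPs : Pᴴ = P) {u : Ω → ℝ}
    (h : toComplex u ᵥ* P = 0) : P *ᵥ toComplex u = 0 := by
  have := congrArg star h
  rwa [star_vecMul, hPs, star_toComplex, star_zero] at this

/-- Induction over the central idempotents of a matrix algebra along a property that is additive
and holds for the primitive ones. -/
theorem IsCentralIdempotent.induction {𝒜 : Subalgebra ℂ (Matrix Ω Ω ℂ)}
    {p : Matrix Ω Ω ℂ → Prop} (zero : p 0)
    (primitive : ∀ P, IsCentralPrimitiveIdempotent 𝒜 P → p P)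
    (add : ∀ P Q, p P → p Q → p (P + Q)) {P : Matrix Ω Ω ℂ} (hP : IsCentralIdempotent 𝒜 P) :
    p P := by
  -- A nonzero nonprimitive `P` splits as `Q + (P - Q)` with both ranges strictly smaller, and
  -- inclusion of subspaces is well-founded in finite dimension.
  induction hV : LinearMap.range P.mulVecLin using WellFoundedLT.induction generalizing P with
  | ind V ih =>
    subst hV
    by_cases hP0 : P = 0
    · rwa [hP0]
    by_cases hprim : IsCentralPrimitiveIdempotent 𝒜 P
    · exact primitive P hprim
    have hex : ∃ Q, IsCentralIdempotent 𝒜 Q ∧ P * Q = Q ∧ Q ≠ 0 ∧ Q ≠ P := by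
      by_contra! hcon
      exact hprim ⟨hP, hP0, fun Q hQ hPQ => or_iff_not_imp_left.mpr (hcon Q hQ hPQ)⟩
    obtain ⟨Q, hQ, hPQ, hQ0, hQP⟩ := hex
    have hQP' : Q * P = Q := by rw [hQ.2.2 P hP.1, hPQ]
    have lt : ∀ R : Matrix Ω Ω ℂ, R * R = R → P * R = R → R * P = R → R ≠ P →
        LinearMap.range R.mulVecLin < LinearMap.range P.mulVecLin := by
      intro R hRR hPR hRP hne
      refine lt_of_le_of_ne ?_ fun heq => hne ?_
      · rintro _ ⟨v, rfl⟩
        exact ⟨R *ᵥ v, by simp [hPR]⟩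
      -- With equal ranges, the idempotent `R` fixes the range of `P`, so `R = RP = P`.
      · refine Matrix.toLin'.injective (LinearMap.ext fun v => ?_)
        have : P.mulVecLin v ∈ LinearMap.range R.mulVecLin := heq ▸ ⟨v, rfl⟩
        obtain ⟨z, hz⟩ := this
        simp only [mulVecLin_apply] at hz
        simp only [toLin'_apply]
        calc R *ᵥ v = R *ᵥ (P *ᵥ v) := by rw [mulVec_mulVec, hRP]
          _ = P *ᵥ v := by rw [← hz, mulVec_mulVec, hRR]
    have hR : IsCentralIdempotent 𝒜 (P - Q) := by
      refine ⟨sub_mem hP.1 hQ.1, ?_, fun A hA => ?_⟩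
      · rw [sub_mul, mul_sub, mul_sub, hP.2.1, hPQ, hQP', hQ.2.1]; simp
      · rw [sub_mul, mul_sub, hP.2.2 A hA, hQ.2.2 A hA]
    have h1 := ih _ (lt Q hQ.2.1 hPQ hQP' hQP) hQ rfl
    have h2 := ih _ (lt (P - Q) hR.2.1 (by rw [mul_sub, hP.2.1, hPQ])
      (by rw [sub_mul, hP.2.1, hQP']) (by simpa using hQ0)) hR rfl
    simpa using add _ _ h1 h2

/-- A normal matrix and its square have the same kernel: two Gram matrices vanish in turn, that of
`NᴴNa` and that of `Na`. -/
theorem mul_eq_zero_of_mul_mul_eq_zero {N a : Matrix Ω Ω ℂ} (hN : N * Nᴴ = Nᴴ * N)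
    (h : N * (N * a) = 0) : N * a = 0 := by
  have h1 : (Nᴴ * (N * a))ᴴ * (Nᴴ * (N * a)) = 0 := by
    have e : N * (Nᴴ * (N * a)) = Nᴴ * (N * (N * a)) := by
      rw [← mul_assoc, hN, mul_assoc]
    rw [conjTranspose_mul, conjTranspose_conjTranspose, mul_assoc, e, h, mul_zero, mul_zero]
  have h2 := conjTranspose_mul_self_eq_zero.mp h1
  refine conjTranspose_mul_self_eq_zero.mp ?_
  rw [conjTranspose_mul, mul_assoc, h2, mul_zero]

/-- Normal elements of a matrix algebra are von Neumann regular in it. -/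
theorem exists_mul_mul_eq_self {𝒜 : Subalgebra ℂ (Matrix Ω Ω ℂ)} {N : Matrix Ω Ω ℂ}
    (hmem : N ∈ 𝒜) (hN : N * Nᴴ = Nᴴ * N) : ∃ a ∈ 𝒜, N * (N * a) = N := by
  -- Working on `𝒜` itself keeps `a` inside the algebra. Equal kernels of `L` and `L²` force equal
  -- ranges by dimension, and `N = L 1`.
  let L : 𝒜 →ₗ[ℂ] 𝒜 := LinearMap.mulLeft ℂ ⟨N, hmem⟩
  have hker : LinearMap.ker (L ∘ₗ L) = LinearMap.ker L := by
    refine le_antisymm (fun a ha => ?_) (LinearMap.ker_le_ker_comp L L)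
    exact Subtype.ext (mul_eq_zero_of_mul_mul_eq_zero hN (congrArg Subtype.val ha))
  have hrange : LinearMap.range (L ∘ₗ L) = LinearMap.range L := by
    refine Submodule.eq_of_le_of_finrank_eq (LinearMap.range_comp_le_range L L) ?_
    have h1 := LinearMap.finrank_range_add_finrank_ker (L ∘ₗ L)
    have h2 := LinearMap.finrank_range_add_finrank_ker L
    rw [hker] at h1
    omega
  have hmemL : (⟨N, hmem⟩ : 𝒜) ∈ LinearMap.range (L ∘ₗ L) := by
    rw [hrange]
    exact ⟨1, mul_one _⟩
  obtain ⟨a, ha⟩ := hmemL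
  exact ⟨a, a.2, congrArg Subtype.val ha⟩

/-- In a commutative matrix algebra closed under conjugate transposition, the ideal generated by a
primitive idempotent is one-dimensional. -/
theorem IsCentralPrimitiveIdempotent.exists_mul_eq_smul {𝒜 : Subalgebra ℂ (Matrix Ω Ω ℂ)}
    (hstar : ∀ A ∈ 𝒜, Aᴴ ∈ 𝒜) (hcomm : ∀ A ∈ 𝒜, ∀ B ∈ 𝒜, A * B = B * A) {P : Matrix Ω Ω ℂ}
    (hP : IsCentralPrimitiveIdempotent 𝒜 P) {M : Matrix Ω Ω ℂ} (hM : M ∈ 𝒜) :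
    ∃ c : ℂ, P * M = c • P := by
  obtain ⟨⟨hPm, hPP, hPc⟩, hP0, hprim⟩ := hP
  let V := LinearMap.range P.mulVecLin
  have hmaps : ∀ v ∈ V, (P * M).mulVecLin v ∈ V := fun v _ => ⟨M *ᵥ v, by simp⟩
  have : Nontrivial V := by
    rw [Submodule.nontrivial_iff_ne_bot]
    intro h
    refine hP0 (Matrix.toLin'.injective ?_)
    rw [map_zero]
    exact LinearMap.range_eq_bot.mp h
  -- An eigenvalue of `PM` on the range of `P` is the only candidate for `c`; its eigenvector is a
  -- nonzero vector fixed by `P` and killed by `N = PM - μP`.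
  obtain ⟨μ, hμ⟩ := Module.End.exists_eigenvalue ((P * M).mulVecLin.restrict hmaps)
  obtain ⟨⟨v, hvV⟩, hv⟩ := hμ.exists_hasEigenvector
  have hv0 : v ≠ 0 := fun h => hv.2 (Subtype.ext h)
  have hPMv : (P * M) *ᵥ v = μ • v := congrArg Subtype.val hv.apply_eq_smul
  have hPv : P *ᵥ v = v := by
    obtain ⟨z, rfl⟩ := hvV
    simp [hPP]
  set N := P * M - μ • P with hNdef
  have hNm : N ∈ 𝒜 := sub_mem (mul_mem hPm hM) (Subalgebra.smul_mem _ hPm _)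
  have hPN : P * N = N := by rw [hNdef, mul_sub, mul_smul_comm, ← mul_assoc, hPP]
  have hNv : N *ᵥ v = 0 := by
    rw [hNdef, sub_mulVec, hPMv, smul_mulVec, hPv, sub_self]
  -- Regularity makes `Na` an idempotent below `P`. If it is `0` then `N = 0`; if it is `P` then `v
  -- = Pv = aNv = 0`, which is impossible.
  obtain ⟨a, ha, hNa⟩ := exists_mul_mul_eq_self hNm (hcomm _ hNm _ (hstar _ hNm))
  have hE : IsCentralIdempotent 𝒜 (N * a) := by
    refine ⟨mul_mem hNm ha, ?_, fun A hA => hcomm _ (mul_mem hNm ha) _ hA⟩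
    rw [hcomm _ (mul_mem hNm ha) _ (mul_mem hNm ha), mul_assoc,
      ← mul_assoc a, hcomm a ha N hNm, ← mul_assoc, ← mul_assoc, mul_assoc N N a, hNa]
  refine ⟨μ, sub_eq_zero.mp (show N = 0 from ?_)⟩
  rcases hprim _ hE (by rw [← mul_assoc, hPN]) with h | h
  · rw [← hNa, h, mul_zero]
  · refine absurd ?_ hv0
    rw [← hPv, ← h, hcomm N hNm a ha, ← mulVec_mulVec, hNv, mulVec_zero]

end Algebra

/-! ### Invariance and averaging under a transitive group. -/

section Group

variable {Ω : Type*} [Fintype Ω] [DecidableEq Ω] {G : Type*} [Group G] [MulAction G Ω]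

omit [DecidableEq Ω] in
theorem mulVec_translate {A : Matrix Ω Ω ℂ} (hA : ∀ (g : G) i j, A (g • i) (g • j) = A i j)
    (g : G) (v : Ω → ℂ) : A *ᵥ translate g v = translate g (A *ᵥ v) := by
  ext i
  simp only [mulVec, dotProduct, translate]
  rw [← Equiv.sum_comp (MulAction.toPerm g)]
  refine Finset.sum_congr rfl fun j _ => ?_
  rw [MulAction.toPerm_apply, inv_smul_smul, ← hA g⁻¹, inv_smul_smul]

omit [DecidableEq Ω] in
theorem hermForm_translate {A : Matrix Ω Ω ℂ} (hA : ∀ (g : G) i j, A (g • i) (g • j) = A i j)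
    (g : G) (v : Ω → ℂ) : hermForm A (translate g v) = hermForm A v := by
  simp only [hermForm, translate]
  rw [← Equiv.sum_comp (MulAction.toPerm g)]
  refine Finset.sum_congr rfl fun i _ => ?_
  rw [← Equiv.sum_comp (MulAction.toPerm g)]
  refine Finset.sum_congr rfl fun j _ => ?_
  simp only [MulAction.toPerm_apply, inv_smul_smul, hA]

omit [DecidableEq Ω] in
theorem principalIdempotent_mul_self [Nonempty Ω] :
    principalIdempotent Ω * principalIdempotent Ω = principalIdempotent Ω := by
  ext i j
  have : (Fintype.card Ω : ℂ) ≠ 0 := by simp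
  simp [principalIdempotent, mul_apply, this]

omit [DecidableEq Ω] in
-- Transitivity makes all row sums equal and all column sums equal; the two common values agree
-- because each, times `n`, is the total of all entries.
theorem principalIdempotent_mul_comm [MulAction.IsPretransitive G Ω] [Nonempty Ω]
    {A : Matrix Ω Ω ℂ} (hA : ∀ (g : G) i j, A (g • i) (g • j) = A i j) :
    principalIdempotent Ω * A = A * principalIdempotent Ω := by
  have hcol : ∀ j j', ∑ k, A k j = ∑ k, A k j' := by
    intro j j'
    obtain ⟨g, rfl⟩ := MulAction.exists_smul_eq G j j'
    rw [← Equiv.sum_comp (MulAction.toPerm g) fun k => A k (g • j)]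
    exact Finset.sum_congr rfl fun k _ => (hA g k j).symm
  have hrow : ∀ i i', ∑ k, A i k = ∑ k, A i' k := by
    intro i i'
    obtain ⟨g, rfl⟩ := MulAction.exists_smul_eq G i i'
    rw [← Equiv.sum_comp (MulAction.toPerm g) fun k => A (g • i) k]
    exact Finset.sum_congr rfl fun k _ => (hA g i k).symm
  have hn : (Fintype.card Ω : ℂ) ≠ 0 := by simp
  ext i j
  simp only [mul_apply, principalIdempotent, of_apply, ← Finset.mul_sum, ← Finset.sum_mul]
  rw [mul_comm]
  congr 1
  refine mul_left_cancel₀ hn ?_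
  calc (Fintype.card Ω : ℂ) * ∑ k, A k j = ∑ l : Ω, ∑ k, A k l := by
        rw [Finset.sum_congr rfl fun l _ => hcol l j]; simp
    _ = ∑ k : Ω, ∑ l, A k l := Finset.sum_comm
    _ = (Fintype.card Ω : ℂ) * ∑ k, A i k := by
        rw [Finset.sum_congr rfl fun l _ => hrow l i]; simp

/-- If `w` and `x` are design-orthogonal, then `w · x^g` has its average value for every `g`. -/
theorem dot_translate_of_designOrthogonal [MulAction.IsPretransitive G Ω] [Nonempty Ω]
    {𝓡 : Set (Set (Ω × Ω))} (hconv : ∀ R ∈ 𝓡, converse R ∈ 𝓡)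
    (hinv : ∀ R ∈ 𝓡, ∀ (g : G) (p : Ω × Ω), g • p ∈ R ↔ p ∈ R) {w x : Ω → ℝ}
    (h : DesignOrthogonal 𝓡 (toComplex w) (toComplex x)) (g : G) :
    dot w (translate g x) = size w * size x / Fintype.card Ω := by
  have hA : ∀ A ∈ adjAlgebra 𝓡, ∀ (g : G) i j, A (g • i) (g • j) = A i j :=
    fun A hA => apply_smul_of_mem_adjAlgebra hinv hA
  have hstar : ∀ A ∈ adjAlgebra 𝓡, Aᴴ ∈ adjAlgebra 𝓡 :=
    fun A hA => conjTranspose_mem_adjAlgebra hconv hA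
  -- The factor `1 - J/n` removes the principal component, so the claim is additive in the left
  -- factor and can be checked on primitive idempotents.
  have key : toComplex w ⬝ᵥ
      ((1 : Matrix Ω Ω ℂ) * (1 - principalIdempotent Ω)) *ᵥ translate g (toComplex x) = 0 := by
    refine IsCentralIdempotent.induction (𝒜 := adjAlgebra 𝓡)
      (p := fun P => toComplex w ⬝ᵥ
        (P * (1 - principalIdempotent Ω)) *ᵥ translate g (toComplex x) = 0) ?_ ?_ ?_ ?_
    · simp
    · intro P hP
      by_cases hPJ : P = principalIdempotent Ω
      · rw [hPJ, mul_sub, principalIdempotent_mul_self, mul_one, sub_self, zero_mulVec,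
          dotProduct_zero]
      have hPs := hP.1.conjTranspose_eq hstar
      rcases mul_eq_zero.mp (h P hP hPJ) with h0 | h0
      · rw [← mulVec_mulVec, dotProduct_mulVec,
          vecMul_eq_zero_of_hermForm_eq_zero hP.1.2.1 hPs h0, zero_dotProduct]
      · have h1 := mulVec_toComplex_eq_zero_of_vecMul hPs
          (vecMul_eq_zero_of_hermForm_eq_zero hP.1.2.1 hPs h0)
        have hc : P * (1 - principalIdempotent Ω) = (1 - principalIdempotent Ω) * P := by
          rw [mul_sub, sub_mul, principalIdempotent_mul_comm (hA P hP.1.1), mul_one, one_mul]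
        rw [hc, ← mulVec_mulVec, mulVec_translate (hA P hP.1.1), h1]
        exact (congrArg _ (mulVec_zero _)).trans (dotProduct_zero _)
    · intro P Q hP hQ
      rw [add_mul, add_mulVec, dotProduct_add, hP, hQ, add_zero]
    · exact ⟨one_mem _, one_mul _, fun A _ => by rw [one_mul, mul_one]⟩
  rw [one_mul, sub_mulVec, one_mulVec, dotProduct_sub, sub_eq_zero] at key
  have hx : ∑ i, x (g⁻¹ • i) = ∑ i, x i := Equiv.sum_comp (MulAction.toPerm g⁻¹) x
  refine Complex.ofReal_injective ?_
  calc ((dot w (translate g x) : ℝ) : ℂ)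
      = toComplex w ⬝ᵥ translate g (toComplex x) := by
        simp [dot, dotProduct, translate, toComplex]
    _ = ((size w * (∑ i, x (g⁻¹ • i)) / Fintype.card Ω : ℝ) : ℂ) := by
        rw [key]
        simp only [dotProduct, mulVec, principalIdempotent, of_apply, translate, toComplex, size,
          ← Finset.mul_sum, ← Finset.sum_mul]
        push_cast
        ring
    _ = _ := by rw [hx, size, size]

omit [Fintype Ω] [DecidableEq Ω] in
theorem sum_translate_eq [MulAction.IsPretransitive G Ω] [Fintype G] {k : Type*} [Semiring k]
    (x : Ω → k) (i j : Ω) : ∑ g : G, translate g x i = ∑ g : G, translate g x j := by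
  obtain ⟨h, rfl⟩ := MulAction.exists_smul_eq G i j
  rw [← Equiv.sum_comp (Equiv.mulLeft h) fun g => translate g x (h • i)]
  refine Finset.sum_congr rfl fun g _ => ?_
  rw [Equiv.coe_mulLeft, translate, translate, _root_.mul_inv_rev, mul_smul, inv_smul_smul]

omit [DecidableEq Ω] in
theorem card_mul_sum_translate [MulAction.IsPretransitive G Ω] [Fintype G] {k : Type*} [Semiring k]
    (x : Ω → k) (i : Ω) :
    (Fintype.card Ω : k) * ∑ g : G, translate g x i = Fintype.card G * ∑ j, x j := by
  calc (Fintype.card Ω : k) * ∑ g : G, translate g x i = ∑ j : Ω, ∑ g : G, translate g x j := by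
        rw [Finset.sum_congr rfl fun j _ => sum_translate_eq x j i]; simp
    _ = ∑ g : G, ∑ j : Ω, x (g⁻¹ • j) := Finset.sum_comm
    _ = ∑ g : G, ∑ j, x j :=
        Finset.sum_congr rfl fun g _ => Equiv.sum_comp (MulAction.toPerm g⁻¹) x
    _ = _ := by simp

omit [DecidableEq Ω] in
/-- If `w · x^g` does not depend on `g`, then it is `|w| |x| / |Ω|`. -/
theorem dot_translate_eq_of_forall_eq [MulAction.IsPretransitive G Ω] [Finite G] [Nonempty Ω]
    {w x : Ω → ℝ} {c : ℝ} (h : ∀ g : G, dot w (translate g x) = c) :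
    c = size w * size x / Fintype.card Ω := by
  have := Fintype.ofFinite G
  have hn : (Fintype.card Ω : ℝ) ≠ 0 := by simp
  have hG : (Fintype.card G : ℝ) ≠ 0 := by simp
  have havg := fun i : Ω => card_mul_sum_translate (G := G) x i
  rw [eq_div_iff hn]
  refine mul_left_cancel₀ hG ?_
  calc (Fintype.card G : ℝ) * (c * Fintype.card Ω)
      = (∑ g : G, dot w (translate g x)) * Fintype.card Ω := by simp [h, mul_assoc]
    _ = (∑ i, w i * ∑ g : G, x (g⁻¹ • i)) * Fintype.card Ω := by
        simp only [dot, translate, Finset.mul_sum]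
        rw [Finset.sum_comm]
    _ = ∑ i, w i * ((Fintype.card Ω : ℝ) * ∑ g : G, x (g⁻¹ • i)) := by
        rw [Finset.sum_mul]
        exact Finset.sum_congr rfl fun i _ => by ring
    _ = (Fintype.card G : ℝ) * (size w * size x) := by
        simp only [translate] at havg
        simp only [havg]
        rw [← Finset.sum_mul, size, size]
        ring

/-- A primitive central idempotent other than `J / n` is orthogonal to `J / n`. -/
theorem IsCentralPrimitiveIdempotent.mul_principalIdempotent [Nonempty Ω]
    {𝒜 : Subalgebra ℂ (Matrix Ω Ω ℂ)} (hJ : IsCentralIdempotent 𝒜 (principalIdempotent Ω))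
    {P : Matrix Ω Ω ℂ} (hP : IsCentralPrimitiveIdempotent 𝒜 P)
    (hne : P ≠ principalIdempotent Ω) : P * principalIdempotent Ω = 0 := by
  set J := principalIdempotent Ω with hJdef
  obtain ⟨⟨hPm, hPP, hPc⟩, hP0, hprim⟩ := hP
  have hPJ : P * J = J * P := hPc J hJ.1
  refine (hprim (P * J) ⟨mul_mem hPm hJ.1, ?_, fun A hA => ?_⟩ ?_).resolve_right fun heq => ?_
  · rw [mul_assoc, ← mul_assoc J, ← hPJ, mul_assoc P, hJ.2.1, ← mul_assoc, hPP]
  · rw [mul_assoc, hJ.2.2 A hA, ← mul_assoc, hPc A hA, mul_assoc]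
  · rw [← mul_assoc, hPP]
  -- Here `P = PJ/n = (J/n)P`, so all entries of `P` are one number `p`, and idempotency reads `np²
  -- = p`: either `p = 0` or `p = 1/n`.
  · have hcol : ∀ i j j', P i j = P i j' := fun i j j' => by
      rw [← heq]; simp [mul_apply, hJdef, principalIdempotent]
    have hrow : ∀ i i' j, P i j = P i' j := fun i i' j => by
      rw [← heq, hPJ]; simp [mul_apply, hJdef, principalIdempotent]
    have hn : (Fintype.card Ω : ℂ) ≠ 0 := by simp
    obtain ⟨o⟩ := ‹Nonempty Ω›
    have hsq : (Fintype.card Ω : ℂ) * (P o o * P o o) = P o o := by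
      conv_rhs => rw [← hPP, mul_apply, Finset.sum_congr rfl fun k _ =>
        show P o k * P k o = P o o * P o o by rw [hcol o k o, hrow k o o]]
      simp
    by_cases hp : P o o = 0
    · exact hP0 (ext fun i j => by rw [hrow i o, hcol o j o, hp, Matrix.zero_apply])
    · refine hne (ext fun i j => ?_)
      rw [hrow i o, hcol o j o, hJdef, principalIdempotent, of_apply]
      refine eq_inv_of_mul_eq_one_right (mul_right_cancel₀ hp ?_)
      rw [mul_assoc, hsq, one_mul]

/-- If `w · x^g` has its average value for every `g`, then `w` and `x` are design-orthogonal in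
every commutative configuration between the orbital configuration and its symmetrisation. -/
theorem designOrthogonal_of_dot_translate [MulAction.IsPretransitive G Ω] [Finite G] [Nonempty Ω]
    {𝓡 : Set (Set (Ω × Ω))} (hconv : ∀ R ∈ 𝓡, converse R ∈ 𝓡) (hcomm : IsCommutative 𝓡)
    (hinv : ∀ R ∈ 𝓡, ∀ (g : G) (p : Ω × Ω), g • p ∈ R ↔ p ∈ R)
    (hmem : ∀ M : Matrix Ω Ω ℂ, (∀ (g : G) i j, M (g • i) (g • j) = M i j) →
      (∀ i j, M i j = M j i) → M ∈ adjAlgebra 𝓡) {w x : Ω → ℝ}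
    (h : ∀ g : G, dot w (translate g x) = size w * size x / Fintype.card Ω) :
    DesignOrthogonal 𝓡 (toComplex w) (toComplex x) := by
  intro P hP hPJ
  have := Fintype.ofFinite G
  have hn : (Fintype.card Ω : ℝ) ≠ 0 := by simp
  have hA : ∀ A ∈ adjAlgebra 𝓡, ∀ (g : G) i j, A (g • i) (g • j) = A i j :=
    fun A hA => apply_smul_of_mem_adjAlgebra hinv hA
  have hstar : ∀ A ∈ adjAlgebra 𝓡, Aᴴ ∈ adjAlgebra 𝓡 :=
    fun A hA => conjTranspose_mem_adjAlgebra hconv hA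
  have hJ : IsCentralIdempotent (adjAlgebra 𝓡) (principalIdempotent Ω) :=
    ⟨hmem _ (fun _ _ _ => rfl) fun _ _ => rfl, principalIdempotent_mul_self,
      fun A hA' => principalIdempotent_mul_comm (hA A hA')⟩
  have hPs := hP.1.conjTranspose_eq hstar
  have hP1 : (fun _ => (1 : ℂ)) ᵥ* P = 0 := by
    have h1 : principalIdempotent Ω * P = 0 := by
      rw [← hP.1.2.2 _ hJ.1]; exact hP.mul_principalIdempotent hJ hPJ
    ext j
    have h2 := congrFun (congrFun h1 j) j
    simpa [mul_apply, principalIdempotent, ← Finset.mul_sum, vecMul, dotProduct] using h2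
  -- Centring turns the average-value hypothesis into orthogonality of `w` to every translate of
  -- `y`.
  set y : Ω → ℝ := fun i => x i - size x / Fintype.card Ω with hy
  have hyw : ∀ g : G, ∑ i, translate g (toComplex y) i * toComplex w i = 0 := by
    intro g
    have h1 : ∑ i, y (g⁻¹ • i) * w i = 0 := by
      calc ∑ i, y (g⁻¹ • i) * w i
          = dot w (translate g x) - size w * (size x / Fintype.card Ω) := by
            simp only [hy, dot, size, translate, Finset.sum_mul, ← Finset.sum_sub_distrib]
            exact Finset.sum_congr rfl fun i _ => by ring
        _ = 0 := by rw [h g]; ring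
    have h2 := congrArg Complex.ofReal h1
    simpa [translate, toComplex] using h2
  let M : Matrix Ω Ω ℂ := of fun i j =>
    ∑ g : G, translate g (toComplex y) i * translate g (toComplex y) j
  have hM : M ∈ adjAlgebra 𝓡 := by
    refine hmem M (fun k i j => ?_) fun i j => Finset.sum_congr rfl fun g _ => mul_comm _ _
    simp only [M, of_apply, translate]
    rw [← Equiv.sum_comp (Equiv.mulLeft k)]
    refine Finset.sum_congr rfl fun g _ => ?_
    rw [Equiv.coe_mulLeft, _root_.mul_inv_rev, mul_smul, mul_smul, inv_smul_smul, inv_smul_smul]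
  have hMw : M *ᵥ toComplex w = 0 := by
    ext i
    simp only [M, mulVec, dotProduct, of_apply, Finset.sum_mul]
    rw [Finset.sum_comm]
    refine Finset.sum_eq_zero fun g _ => ?_
    simp only [mul_assoc]
    rw [← Finset.mul_sum, hyw g, mul_zero]
  -- Each rank-one summand contributes `y^g P (y^g)*`, which is independent of `g` because `P` is
  -- invariant.
  have htr : trace (P * M) = Fintype.card G * hermForm P (toComplex y) := by
    calc trace (P * M)
        = ∑ g : G, hermForm P (translate g (toComplex y)) := by
          simp only [trace, diag_apply, mul_apply, M, of_apply, hermForm, Finset.mul_sum]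
          symm
          rw [Finset.sum_comm]
          refine Finset.sum_congr rfl fun i _ => ?_
          rw [Finset.sum_comm]
          refine Finset.sum_congr rfl fun k _ => Finset.sum_congr rfl fun g _ => ?_
          rw [show star (translate g (toComplex y) k) = translate g (toComplex y) k from
            Complex.conj_ofReal _]
          ring
      _ = _ := by simp [hermForm_translate (hA P hP.1.1)]
  obtain ⟨c, hc⟩ := hP.exists_mul_eq_smul hstar
    (fun A hA' B hB => mul_comm_of_mem_adjAlgebra hcomm hA' hB) hM
  have hcw : c • P *ᵥ toComplex w = 0 := by
    rw [← smul_mulVec, ← hc, ← mulVec_mulVec, hMw, mulVec_zero]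
  -- If `c = 0`, the trace kills `yP`, and `x` differs from `y` by a constant vector, which `P` also
  -- kills. Otherwise `P` kills `w`.
  rcases smul_eq_zero.mp hcw with h0 | h0
  · have hG : (Fintype.card G : ℂ) ≠ 0 := by simp
    rw [hc, h0, zero_smul, trace_zero, eq_comm, mul_eq_zero, or_iff_right hG] at htr
    have hyP := vecMul_eq_zero_of_hermForm_eq_zero hP.1.2.1 hPs htr
    have hxy : toComplex x = toComplex y +
        ((size x / Fintype.card Ω : ℝ) : ℂ) • (fun _ => (1 : ℂ)) := by
      ext i; simp [toComplex, hy]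
    rw [hermForm_eq P (toComplex x), hxy, add_vecMul, hyP, smul_vecMul, hP1]
    simp
  · rw [hermForm_eq, star_toComplex, ← dotProduct_mulVec, h0, dotProduct_zero, zero_mul]

end Group

/-! ### The orbital configuration and its symmetrisation. -/

section Orbitals

variable {Ω : Type*} [Fintype Ω] [DecidableEq Ω] {G : Type*} [Group G] [MulAction G Ω]

omit [Fintype Ω] [DecidableEq Ω] in
theorem smul_mem_orbital_iff {R : Set (Ω × Ω)} (hR : R ∈ orbitals G Ω) (g : G) (p : Ω × Ω) :
    g • p ∈ R ↔ p ∈ R := by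
  obtain ⟨q, rfl⟩ := hR
  rw [← MulAction.orbit_eq_iff, ← MulAction.orbit_eq_iff, MulAction.orbit_smul]

omit [Fintype Ω] [DecidableEq Ω] in
theorem smul_mem_symmetrisation_iff {R : Set (Ω × Ω)} (hR : R ∈ symmetrisation (orbitals G Ω))
    (g : G) (p : Ω × Ω) : g • p ∈ R ↔ p ∈ R := by
  obtain ⟨S, hS, rfl⟩ := hR
  exact or_congr (smul_mem_orbital_iff hS g p) (smul_mem_orbital_iff hS g (p.2, p.1))

omit [Fintype Ω] [DecidableEq Ω] in
theorem eq_of_mem_orbital {α : Type*} {M : Matrix Ω Ω α}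
    (hM : ∀ (g : G) i j, M (g • i) (g • j) = M i j) {R : Set (Ω × Ω)} (hR : R ∈ orbitals G Ω)
    {p q : Ω × Ω} (hp : p ∈ R) (hq : q ∈ R) : M p.1 p.2 = M q.1 q.2 := by
  obtain ⟨r, rfl⟩ := hR
  obtain ⟨g, rfl⟩ := hp
  obtain ⟨k, rfl⟩ := hq
  exact (hM g _ _).trans (hM k _ _).symm

theorem designOrthogonal_orbitals_of_dot_translate [MulAction.IsPretransitive G Ω] [Finite G]
    [Nonempty Ω] (hcomm : IsCommutative (orbitals G Ω)) {w x : Ω → ℝ}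
    (h : ∀ g : G, dot w (translate g x) = size w * size x / Fintype.card Ω) :
    DesignOrthogonal (orbitals G Ω) (toComplex w) (toComplex x) :=
  designOrthogonal_of_dot_translate (isHomogeneousCoherent_orbitals G Ω).converse_mem hcomm
    (fun _ hR => smul_mem_orbital_iff hR)
    (fun _ hM _ => mem_adjAlgebra_of_forall_mem_eq (isHomogeneousCoherent_orbitals G Ω).partition
      fun _ hR _ hp _ hq => eq_of_mem_orbital hM hR hp hq) h

theorem designOrthogonal_symmetrisation_of_dot_translate [MulAction.IsPretransitive G Ω]
    [Finite G] [Nonempty Ω] (hstrat : IsStratifiable (orbitals G Ω)) {w x : Ω → ℝ}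
    (h : ∀ g : G, dot w (translate g x) = size w * size x / Fintype.card Ω) :
    DesignOrthogonal (symmetrisation (orbitals G Ω)) (toComplex w) (toComplex x) := by
  refine designOrthogonal_of_dot_translate hstrat.1.converse_mem hstrat.2
    (fun _ hR => smul_mem_symmetrisation_iff hR) (fun M hM hs => ?_) h
  refine mem_adjAlgebra_of_forall_mem_eq hstrat.1.partition ?_
  rintro _ ⟨R, hR, rfl⟩ p hp q hq
  -- Symmetry of `M` moves a pair from the converse of `R` back into `R`.
  rcases hp with hp | hp <;> rcases hq with hq | hq
  · exact eq_of_mem_orbital hM hR hp hq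
  · rw [hs q.1]; exact eq_of_mem_orbital hM hR hp hq
  · rw [hs p.1]; exact eq_of_mem_orbital hM hR hp hq
  · rw [hs p.1, hs q.1]; exact eq_of_mem_orbital hM hR hp hq

end Orbitals

end SyncHierarchy

namespace SyncHierarchy

/-! ### The rational permutation module. -/

section Rational

variable {Ω : Type*} [Fintype Ω] {G : Type*} [Group G] [MulAction G Ω]

/-- In a complement of the trivial submodule of the permutation module lie exactly the vectors with
coordinate sum zero. -/
theorem mem_iff_sum_eq_zero [MulAction.IsPretransitive G Ω] [Finite G] [Nonempty Ω]
    {T W : Subrepresentation (permModule G Ω)} (hTW : IsCompl T W)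
    (hT1 : Module.finrank ℚ T.toSubmodule = 1) (hT : T.toRepresentation.IsTrivial) (v : Ω → ℚ) :
    v ∈ W.toSubmodule ↔ ∑ i, v i = 0 := by
  have := Fintype.ofFinite G
  have hn : (Fintype.card Ω : ℚ) ≠ 0 := by simp
  have hG : (Fintype.card G : ℚ) ≠ 0 := by simp
  obtain ⟨o⟩ := ‹Nonempty Ω›
  have hTconst : ∀ t ∈ T.toSubmodule, t = fun _ => t o := by
    intro t ht
    ext i
    obtain ⟨g, rfl⟩ := MulAction.exists_smul_eq G o i
    have h1 : permModule G Ω g t = t :=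
      congrArg Subtype.val (T.toRepresentation.isTrivial_apply g ⟨t, ht⟩)
    have h2 : t (g⁻¹ • g • o) = t (g • o) := congrFun h1 (g • o)
    rw [← h2, inv_smul_smul]
  -- Having dimension one and only constant vectors, `T` is exactly the line of constants.
  have hconstT : ∀ c : ℚ, (fun _ => c) ∈ T.toSubmodule := by
    intro c
    obtain ⟨t, ht0⟩ := (Module.finrank_pos_iff_exists_ne_zero (R := ℚ)).mp (hT1 ▸ Nat.one_pos)
    have h1 := hTconst t t.2
    have h2 : (t : Ω → ℚ) o ≠ 0 := by
      intro h
      refine ht0 (Subtype.ext ?_)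
      rw [h1, h]
      rfl
    have h3 := T.toSubmodule.smul_mem (c / (t : Ω → ℚ) o) t.2
    have h4 : (c / (t : Ω → ℚ) o) • (t : Ω → ℚ) = fun _ => c := by
      rw [h1]
      ext
      simp [h2]
    rwa [h4] at h3
  have hinf : T.toSubmodule ⊓ W.toSubmodule = ⊥ :=
    congrArg Subrepresentation.toSubmodule hTW.inf_eq_bot
  have hsup : T.toSubmodule ⊔ W.toSubmodule = ⊤ :=
    congrArg Subrepresentation.toSubmodule hTW.sup_eq_top
  have hW : ∀ v ∈ W.toSubmodule, ∑ i, v i = 0 := by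
    intro v hv
    -- The orbit sum of `v` is constant and stays in `W`, so it is zero; its entries are `|G|/n`
    -- times the coordinate sum of `v`.
    have hs : (∑ g : G, translate g v) ∈ T.toSubmodule ⊓ W.toSubmodule := by
      refine ⟨?_, sum_mem fun g _ => W.apply_mem_toSubmodule g hv⟩
      have h1 : (∑ g : G, translate g v) = fun _ => ∑ g : G, translate g v o := by
        ext i
        rw [Finset.sum_apply, sum_translate_eq v i o]
      exact h1 ▸ hconstT _
    rw [hinf, Submodule.mem_bot] at hs
    have h1 := card_mul_sum_translate (G := G) v o
    rw [← Finset.sum_apply, hs, Pi.zero_apply, mul_zero, eq_comm, mul_eq_zero] at h1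
    exact h1.resolve_left hG
  refine ⟨hW v, fun hv => ?_⟩
  obtain ⟨t, ht, v', hv', rfl⟩ := Submodule.mem_sup.mp (hsup ▸ Submodule.mem_top (x := v))
  have h1 : ∑ i, t i = 0 := by
    simpa [Finset.sum_add_distrib, hW v' hv'] using hv
  rw [hTconst t ht] at h1 ⊢
  have h2 : t o = 0 := by simpa using h1
  rw [h2]
  convert hv' using 1
  exact zero_add _

/-- Integrality lets the centred vectors `a'`, `b'` of `w`, `x` live in the sum-zero module `W` over
`ℚ`. The vectors of `W` with all translates orthogonal to `a'` form a submodule containing `b' ≠ 0`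
but not `a'`, since `a' · a' ≠ 0`. So `W` is reducible. -/
theorem not_isQI_of_isNonQIWitness [Finite G] {w x : Ω → ℝ} (h : IsNonQIWitness G w x) :
    ¬ IsQI G Ω := by
  rintro ⟨htrans, T, W, hTW, hT1, hT, hW⟩
  obtain ⟨hwN, hwn, hxN, hxn, c, hc⟩ := h
  have hne : Nonempty Ω := ⟨hwn.1.choose⟩
  have hc' := dot_translate_eq_of_forall_eq hc
  have hn : (Fintype.card Ω : ℚ) ≠ 0 := by simp
  choose a ha using hwN
  choose b hb using hxN
  let a' : Ω → ℚ := fun i => a i - (∑ j, (a j : ℚ)) / Fintype.card Ω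
  let b' : Ω → ℚ := fun i => b i - (∑ j, (b j : ℚ)) / Fintype.card Ω
  have hsum : ∀ f : Ω → ℕ, ∑ i, ((f i : ℚ) - (∑ j, (f j : ℚ)) / Fintype.card Ω) = 0 := by
    intro f
    rw [Finset.sum_sub_distrib]
    simp [mul_div_cancel₀, hn]
  have haW : a' ∈ W.toSubmodule := (mem_iff_sum_eq_zero hTW hT1 hT a').mpr (hsum a)
  have hbW : b' ∈ W.toSubmodule := (mem_iff_sum_eq_zero hTW hT1 hT b').mpr (hsum b)
  have hab : ∀ g : G, ∑ i, a' i * b' (g⁻¹ • i) = 0 := by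
    intro g
    have h1 : ∑ i, (a i : ℚ) * b (g⁻¹ • i) = (∑ i, (a i : ℚ)) * (∑ i, (b i : ℚ)) / Fintype.card Ω := by
      have h2 := hc g
      rw [hc'] at h2
      simp only [dot, size, translate, ha, hb] at h2
      refine Rat.cast_injective (α := ℝ) ?_
      push_cast
      exact h2
    have h3 : ∑ i, (b (g⁻¹ • i) : ℚ) = ∑ i, (b i : ℚ) :=
      Equiv.sum_comp (MulAction.toPerm g⁻¹) fun i => (b i : ℚ)
    calc ∑ i, a' i * b' (g⁻¹ • i)
        = ∑ i, (a i : ℚ) * b (g⁻¹ • i) - (∑ i, (a i : ℚ)) * ((∑ j, (b j : ℚ)) / Fintype.card Ω)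
          - (∑ j, (a j : ℚ)) / Fintype.card Ω *
            ∑ i, ((b (g⁻¹ • i) : ℚ) - (∑ j, (b j : ℚ)) / Fintype.card Ω) := by
          rw [Finset.sum_mul, Finset.mul_sum, ← Finset.sum_sub_distrib, ← Finset.sum_sub_distrib]
          exact Finset.sum_congr rfl fun i _ => by simp only [a', b']; ring
      _ = 0 := by
          rw [h1, Finset.sum_sub_distrib, h3, ← Finset.sum_sub_distrib, hsum]
          ring
  let U : Subrepresentation W.toRepresentation :=
    { toSubmodule :=
        { carrier := {v | ∀ g : G, ∑ i, a' i * (v : Ω → ℚ) (g⁻¹ • i) = 0}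
          zero_mem' := fun g => by simp
          add_mem' := fun {v v'} hv hv' g => by
            simp [mul_add, Finset.sum_add_distrib, hv g, hv' g]
          smul_mem' := fun r v hv g => by
            have h1 := congrArg (r * ·) (hv g)
            simp only [Finset.mul_sum, mul_zero] at h1
            rw [← h1]
            exact Finset.sum_congr rfl fun i _ => mul_left_comm _ _ _ }
      apply_mem_toSubmodule := fun k v hv g => by
        rw [← hv (g * k)]
        refine Finset.sum_congr rfl fun i _ => ?_
        rw [mul_inv_rev, mul_smul]
        rfl }
  have hconst : ∀ f : Ω → ℕ, (∀ i, (f i : ℚ) - (∑ j, (f j : ℚ)) / Fintype.card Ω = 0) →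
      ∀ i j, f i = f j := by
    intro f hf i j
    exact_mod_cast (sub_eq_zero.mp (hf i)).trans (sub_eq_zero.mp (hf j)).symm
  rcases hW.eq_bot_or_eq_top U with hU | hU
  · have h1 : (⟨b', hbW⟩ : W.toSubmodule) ∈ U.toSubmodule := hab
    rw [hU] at h1
    have h2 : b' = 0 := congrArg Subtype.val ((Submodule.mem_bot ℚ).mp h1)
    obtain ⟨i, j, hij⟩ := hxn.1
    exact hij (by rw [hb, hb, hconst b (congrFun h2) i j])
  · have h1 : (⟨a', haW⟩ : W.toSubmodule) ∈ U.toSubmodule := by rw [hU]; exact Submodule.mem_top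
    have h2 : ∑ i, a' i * a' i = 0 := by simpa using h1 1
    have h3 : ∀ i, a' i = 0 := fun i => mul_self_eq_zero.mp
      ((Finset.sum_eq_zero_iff_of_nonneg fun i _ => mul_self_nonneg (a' i)).mp h2 i
        (Finset.mem_univ i))
    obtain ⟨i, j, hij⟩ := hwn.1
    exact hij (by rw [ha, ha, hconst a h3 i j])

end Rational

/-! ### Zero-one vectors as sets, and synchronisation. -/

section Vectors

variable {Ω : Type*} [Fintype Ω]

omit [Fintype Ω] in
theorem IsZeroOne.isNatVector {u : Ω → ℝ} (hu : IsZeroOne u) : IsNatVector u := fun ω =>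
  (hu ω).elim (fun h => ⟨0, by simp [h]⟩) fun h => ⟨1, by simp [h]⟩

theorem size_pos {u : Ω → ℝ} (hu : IsNatVector u) (hn : IsNontrivial u) : 0 < size u := by
  have h0 : ∀ i, 0 ≤ u i := fun i => by obtain ⟨k, hk⟩ := hu i; rw [hk]; positivity
  refine lt_of_le_of_ne (Finset.sum_nonneg fun i _ => h0 i) fun h => ?_
  have h1 := (Finset.sum_eq_zero_iff_of_nonneg fun i _ => h0 i).mp h.symm
  obtain ⟨a, b, hab⟩ := hn.1
  exact hab ((h1 a (Finset.mem_univ a)).trans (h1 b (Finset.mem_univ b)).symm)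

theorem exists_dot_eq_natCast {u v : Ω → ℝ} (hu : IsNatVector u) (hv : IsNatVector v) :
    ∃ k : ℕ, dot u v = k := by
  choose a ha using hu
  choose b hb using hv
  exact ⟨∑ i, a i * b i, by simp [dot, ha, hb]⟩

theorem exists_ne_of_isNontrivial {u : Ω → ℝ} (hu : IsZeroOne u) (hn : IsNontrivial u) :
    ∃ a b, a ≠ b ∧ u a = 1 ∧ u b = 1 := by
  have h1 := Set.ncard_add_ncard_compl {ω | u ω = 0}
  rw [Nat.card_eq_fintype_card] at h1
  have h2 : 1 < Set.ncard {ω | u ω = 0}ᶜ := by have := hn.2; omega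
  obtain ⟨a, b, ha, hb, hab⟩ := (Set.one_lt_ncard_iff).mp h2
  exact ⟨a, b, hab, (hu a).resolve_left ha, (hu b).resolve_left hb⟩

theorem existsUnique_of_dot_eq_one {u v : Ω → ℝ} (hu : IsZeroOne u) (hv : IsZeroOne v)
    (h : dot u v = 1) : ∃! ω, u ω = 1 ∧ v ω = 1 := by
  classical
  have h1 : dot u v = (Finset.univ.filter fun ω => u ω = 1 ∧ v ω = 1).card := by
    rw [Finset.card_filter, Nat.cast_sum]
    refine Finset.sum_congr rfl fun ω _ => ?_
    rcases hu ω with h1 | h1 <;> rcases hv ω with h2 | h2 <;> simp [h1, h2]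
  rw [h1] at h
  obtain ⟨ω, hω⟩ := Finset.card_eq_one.mp (by exact_mod_cast h)
  have h2 : ∀ ω', (u ω' = 1 ∧ v ω' = 1) ↔ ω' = ω := fun ω' => by
    have := Finset.ext_iff.mp hω ω'
    simpa using this
  exact ⟨ω, (h2 ω).mpr rfl, fun ω' h' => (h2 ω').mp h'⟩

omit [Fintype Ω] in
theorem existsUnique_of_sum_eq_one {ι : Type*} [Fintype ι] {y : ι → Ω → ℝ}
    (hy : ∀ i, IsZeroOne (y i)) {ω : Ω} (h : ∑ i, y i ω = 1) : ∃! i, y i ω = 1 := by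
  have h1 := existsUnique_of_dot_eq_one (u := fun i => y i ω) (v := fun _ => 1) (fun i => hy i ω)
    (fun _ => Or.inr rfl) (by simpa [dot] using h)
  simpa using h1

/-- Collapse each part `y i` to its unique point in `v`. This `f` and all of `G` send translates of
`v` onto translates of `v`, so no product of them can collapse `v`, which has at least two points,
to a single point. -/
theorem not_isSynchronising_of_isNonsynchronisingWitness {G : Type*} [Group G] [MulAction G Ω]
    {m : ℕ} {y : Fin m → Ω → ℝ} {v : Ω → ℝ} (h : IsNonsynchronisingWitness G y v) :
    ¬ IsSynchronising G Ω := by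
  obtain ⟨hy, hv, hvn, hsum, hdot⟩ := h
  have hpart : ∀ ω, ∃! i, y i ω = 1 := fun ω => existsUnique_of_sum_eq_one (fun i => (hy i).1)
    (hsum ω)
  choose part hpart hpart' using hpart
  have htrans : ∀ i (g : G), ∃! ω, y i ω = 1 ∧ v (g⁻¹ • ω) = 1 := fun i g =>
    existsUnique_of_dot_eq_one (hy i).1 (fun ω => hv (g⁻¹ • ω)) (hdot i g)
  have hsec : ∀ i, ∃! ω, y i ω = 1 ∧ v ω = 1 := fun i => by simpa using htrans i 1
  choose s hs hs' using hsec
  let f : Function.End Ω := fun ω => s (part ω)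
  obtain ⟨a, b, hab, hva, hvb⟩ := exists_ne_of_isNontrivial hv hvn
  intro hsync
  have hf : ¬ Function.Bijective f := by
    intro hf
    -- A nontrivial part has two points, which `f` identifies.
    obtain ⟨p, q, hpq, hp, hq⟩ :=
      exists_ne_of_isNontrivial (hy (part a)).1 (hy (part a)).2
    refine hpq (hf.1 (congrArg s ?_))
    rw [← hpart' p _ hp, ← hpart' q _ hq]
  obtain ⟨c, hc⟩ := hsync f hf
  have himage : ∀ e ∈ Submonoid.closure
      (insert f (Set.range (MulAction.toEndHom : G →* Function.End Ω))), ∀ g : G, ∃ g' : G,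
      e '' {ω | v (g⁻¹ • ω) = 1} = {ω | v (g'⁻¹ • ω) = 1} := by
    intro e he
    induction he using Submonoid.closure_induction with
    | mem e he =>
      intro g
      rcases he with rfl | ⟨k, rfl⟩
      -- A translate of `v` meets every part, so its image under `f` is all of `v`, the translate by
      -- `1`.
      · refine ⟨1, Set.ext fun ω => ⟨?_, fun hω => ?_⟩⟩
        · rintro ⟨ω', -, rfl⟩
          simpa using (hs (part ω')).2
        · obtain ⟨ω', hω', -⟩ := htrans (part ω) g
          refine ⟨ω', hω'.2, ?_⟩
          change s (part ω') = ω
          rw [← hpart' ω' _ hω'.1]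
          exact (hs' _ ω ⟨hpart ω, by simpa using hω⟩).symm
      · refine ⟨k * g, Set.ext fun ω => ⟨?_, fun hω => ⟨k⁻¹ • ω, ?_, smul_inv_smul k ω⟩⟩⟩
        · rintro ⟨ω', hω', rfl⟩
          change v ((k * g)⁻¹ • k • ω') = 1
          rwa [mul_inv_rev, mul_smul, inv_smul_smul]
        · change v (g⁻¹ • k⁻¹ • ω) = 1
          rwa [← mul_smul, ← mul_inv_rev]
    | one => exact fun g => ⟨g, Set.image_id _⟩
    | mul e e' _ _ he he' =>
      intro g
      obtain ⟨g', hg'⟩ := he' g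
      obtain ⟨g'', hg''⟩ := he g'
      refine ⟨g'', ?_⟩
      rw [← hg'', ← hg']
      exact Set.image_comp e e' _
  obtain ⟨g, hg⟩ := himage _ hc 1
  have hmem : ∀ ω, v ω = 1 → g • ω = c := by
    intro ω hω
    have h1 : g • ω ∈ {ω | v (g⁻¹ • ω) = 1} := by simpa using hω
    rw [← hg] at h1
    obtain ⟨_, -, h2⟩ := h1
    exact h2.symm
  exact hab (MulAction.injective g ((hmem a hva).trans (hmem b hvb).symm))

end Vectors

end SyncHierarchy

open SyncHierarchy in
theorem mainTheorem1 {Ω : Type*} [Fintype Ω] [DecidableEq Ω]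
    (G : Subgroup (Equiv.Perm Ω)) [MulAction.IsPretransitive G Ω] :
    -- (a) non-QI
    (∀ w x : Ω → ℝ, IsNatVector w → IsNontrivial w → IsNatVector x → IsNontrivial x →
      (DesignOrthogonal (orbitals G Ω) (toComplex w) (toComplex x) →
        IsNonQIWitness G w x ∧ ¬ IsQI G Ω) ∧
      (IsNonQIWitness G w x →
        (IsStratifiable (orbitals G Ω) →
          DesignOrthogonal (symmetrisation (orbitals G Ω)) (toComplex w) (toComplex x)) ∧
        (IsCommutative (orbitals G Ω) →
          DesignOrthogonal (orbitals G Ω) (toComplex w) (toComplex x)))) ∧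
    -- (b) nonspreading
    (∀ u w : Ω → ℝ, IsZeroOne u → IsNontrivial u → IsNatVector w → IsNontrivial w →
      (∃ d : ℕ, size w = d ∧ d ∣ Fintype.card Ω) →
      (DesignOrthogonal (orbitals G Ω) (toComplex u) (toComplex w) →
        IsNonspreadingWitness G u w ∧ IsNonspreading G Ω) ∧
      (IsNonspreadingWitness G u w →
        (IsStratifiable (orbitals G Ω) →
          DesignOrthogonal (symmetrisation (orbitals G Ω)) (toComplex u) (toComplex w)) ∧
        (IsCommutative (orbitals G Ω) →
          DesignOrthogonal (orbitals G Ω) (toComplex u) (toComplex w)))) ∧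
    -- (c) nonseparating
    (∀ u v : Ω → ℝ, IsZeroOne u → IsNontrivial u → IsZeroOne v → IsNontrivial v →
      size u * size v = Fintype.card Ω →
      (DesignOrthogonal (orbitals G Ω) (toComplex u) (toComplex v) →
        IsNonseparatingWitness G u v ∧ IsNonseparating G Ω) ∧
      (IsNonseparatingWitness G u v →
        (IsStratifiable (orbitals G Ω) →
          DesignOrthogonal (symmetrisation (orbitals G Ω)) (toComplex u) (toComplex v)) ∧
        (IsCommutative (orbitals G Ω) →
          DesignOrthogonal (orbitals G Ω) (toComplex u) (toComplex v)))) ∧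
    -- (d) nonsynchronising
    (∀ (m : ℕ) (y : Fin m → Ω → ℝ) (v : Ω → ℝ),
      (∀ i, IsZeroOne (y i) ∧ IsNontrivial (y i)) → IsZeroOne v → IsNontrivial v →
      (∀ i, size (y i) * size v = Fintype.card Ω) → (∀ ω, ∑ i, y i ω = 1) →
      ((∀ i, DesignOrthogonal (orbitals G Ω) (toComplex (y i)) (toComplex v)) →
        IsNonsynchronisingWitness G y v ∧ ¬ IsSynchronising G Ω) ∧
      (IsNonsynchronisingWitness G y v →
        (IsStratifiable (orbitals G Ω) → ∀ i,
          DesignOrthogonal (symmetrisation (orbitals G Ω)) (toComplex (y i)) (toComplex v)) ∧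
        (IsCommutative (orbitals G Ω) → ∀ i,
          DesignOrthogonal (orbitals G Ω) (toComplex (y i)) (toComplex v)))) := by
  have hne : ∀ {u : Ω → ℝ}, IsNontrivial u → Nonempty Ω := fun h => ⟨h.1.choose⟩
  have fwd : ∀ {u v : Ω → ℝ}, IsNontrivial u →
      DesignOrthogonal (orbitals G Ω) (toComplex u) (toComplex v) →
      ∀ g : G, dot u (translate g v) = size u * size v / Fintype.card Ω := by
    intro u v hu h g
    have := hne hu
    exact dot_translate_of_designOrthogonal (isHomogeneousCoherent_orbitals G Ω).converse_mem
      (fun _ hR => smul_mem_orbital_iff hR) h g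
  have bwd : ∀ {u v : Ω → ℝ} {c : ℝ}, IsNontrivial u → (∀ g : G, dot u (translate g v) = c) →
      (IsStratifiable (orbitals G Ω) →
        DesignOrthogonal (symmetrisation (orbitals G Ω)) (toComplex u) (toComplex v)) ∧
      (IsCommutative (orbitals G Ω) →
        DesignOrthogonal (orbitals G Ω) (toComplex u) (toComplex v)) := by
    intro u v c hu h
    have := hne hu
    have hc := dot_translate_eq_of_forall_eq h
    subst hc
    exact ⟨fun hs => designOrthogonal_symmetrisation_of_dot_translate hs h,
      fun hs => designOrthogonal_orbitals_of_dot_translate hs h⟩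
  have comm : ∀ {𝓡 : Set (Set (Ω × Ω))} {u v : Ω → ℂ},
      DesignOrthogonal 𝓡 u v → DesignOrthogonal 𝓡 v u :=
    fun h P hP hPJ => (mul_comm _ _).trans (h P hP hPJ)
  have one : ∀ {u v : Ω → ℝ}, IsNontrivial u → size u * size v = Fintype.card Ω →
      size u * size v / Fintype.card Ω = 1 := by
    intro u v hu h
    have := hne hu
    rw [h, div_self (by simp)]
  refine ⟨fun w x hwN hw hxN hx => ⟨fun h => ?_, fun h => ?_⟩,
    fun u w hu01 hu hwN hw hd => ⟨fun h => ?_, fun h => ?_⟩,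
    fun u v hu01 hu hv01 hv hsize => ⟨fun h => ?_, fun h => ?_⟩,
    fun m y v hy hv01 hv hsize hsum => ⟨fun h => ?_, fun h => ?_⟩⟩
  · have hwit : IsNonQIWitness G w x := ⟨hwN, hw, hxN, hx, _, fwd hw h⟩
    exact ⟨hwit, not_isQI_of_isNonQIWitness hwit⟩
  · obtain ⟨-, -, -, -, c, hc⟩ := h
    exact bwd hw hc
  -- The witness condition translates `u`, not `w`, hence the swap. The constant is `|w||u|/n`: a
  -- natural number because it equals a dot product of integer vectors, and positive because both
  -- sizes are.
  · have hdot := fwd hw (comm h)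
    obtain ⟨k, hk⟩ := exists_dot_eq_natCast hwN fun ω => hu01.isNatVector ((1 : G)⁻¹ • ω)
    have hk' : size w * size u / Fintype.card Ω = k := (hdot 1).symm.trans hk
    have hpos : (0 : ℝ) < k := by
      have := hne hu
      rw [← hk']
      exact div_pos (mul_pos (size_pos hwN hw) (size_pos hu01.isNatVector hu))
        (by exact_mod_cast Fintype.card_pos)
    have hwit : IsNonspreadingWitness G u w :=
      ⟨hu01, hu, hwN, hw, hd, k, by exact_mod_cast hpos, fun g => (hdot g).trans hk'⟩
    exact ⟨hwit, u, w, hwit⟩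
  · obtain ⟨-, -, -, -, -, l, -, hl⟩ := h
    obtain ⟨h1, h2⟩ := bwd hw hl
    exact ⟨fun hs => comm (h1 hs), fun hs => comm (h2 hs)⟩
  · have hwit : IsNonseparatingWitness G u v :=
      ⟨hu01, hu, hv01, hv, hsize, fun g => (fwd hu h g).trans (one hu hsize)⟩
    exact ⟨hwit, u, v, hwit⟩
  · exact bwd hu h.2.2.2.2.2
  · have hwit : IsNonsynchronisingWitness G y v :=
      ⟨hy, hv01, hv, hsum, fun i g => (fwd (hy i).2 (h i) g).trans (one (hy i).2 (hsize i))⟩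
    exact ⟨hwit, not_isSynchronising_of_isNonsynchronisingWitness hwit⟩
  · exact ⟨fun hs i => (bwd (hy i).2 (h.2.2.2.2 i)).1 hs,
      fun hs i => (bwd (hy i).2 (h.2.2.2.2 i)).2 hs⟩
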